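/- Let $G=(V,E)$ be a finite simple graph. For a bijection $f\colon V\to\{1,2,\dots,|V|\}$ and $v\in V$, let $w_f(v)=\sum_{x\in N(v)}f(x)$, where $N(v)$ is the open neighbourhood of $v$. The bijection $f$ is a local distance antimagic labeling of $G$ if $w_f(u)\neq w_f(v)$ for every edge $uv$ of $G$, and the local distance antimagic chromatic number $\chi_{ld}(G)$ is the minimum of $|\{w_f(v): v\in V\}|$ over all local distance antimagic labelings $f$ of $G$ (and $\infty$ if there are none). The lexicographic product $G[H]$ is the graph on $V(G)\times V(H)$ in which $(g,h)$ and $(g',h')$ are adjacent if and only if $gg'\in E(G)$, or $g=g'$ and $hh'\in E(H)$. For all integers $m\ge 5$ odd and $n\ge 3$, the lexicographic product $C_m[\overline{K_n}]$ of the cycle $C_m$ on $m$ vertices with the complement of the complete graph on $n$ vertices (the graph on $n$ vertices without edges) satisfies $$\chi_{ld}\bigl(C_m[\overline{K_n}]\bigr)=3.$$ -/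

import Mathlib

namespace SimpleGraph

/-- The lexicographic product `G[H]`: `(a, x)` and `(b, y)` are adjacent when `a` and `b` are
adjacent in `G`, or when `a = b` and `x` and `y` are adjacent in `H`. -/
def lexProduct {V W : Type*} (G : SimpleGraph V) (H : SimpleGraph W) : SimpleGraph (V × W) where
  Adj p q := G.Adj p.1 q.1 ∨ (p.1 = q.1 ∧ H.Adj p.2 q.2)
  symm := ⟨fun _ _ h => h.elim (fun h => Or.inl h.symm) (fun h => Or.inr ⟨h.1.symm, h.2.symm⟩)⟩
  loopless := ⟨fun _ h => h.elim (fun h => G.irrefl h) (fun h => H.irrefl h.2)⟩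

instance lexProductDecidableAdj {V W : Type*} (G : SimpleGraph V) (H : SimpleGraph W)
    [DecidableEq V] [DecidableRel G.Adj] [DecidableRel H.Adj] :
    DecidableRel (lexProduct G H).Adj :=
  fun p q => inferInstanceAs (Decidable (G.Adj p.1 q.1 ∨ (p.1 = q.1 ∧ H.Adj p.2 q.2)))

section

variable {V : Type*} [Fintype V] (G : SimpleGraph V) [DecidableRel G.Adj]

/-- The weight of `v` under the labeling `f`: the sum of the labels in its open neighborhood. -/
def distanceWeight (f : V → ℕ) (v : V) : ℕ :=
  ∑ x ∈ G.neighborFinset v, f x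

/-- `f` is a bijection from the vertex set onto `{1, …, |V|}`, and adjacent vertices have
distinct weights. -/
structure IsLocalDistanceAntimagic (f : V → ℕ) : Prop where
  bijOn : Set.BijOn f Set.univ (Set.Icc 1 (Fintype.card V))
  weight_ne : ∀ u v : V, G.Adj u v → G.distanceWeight f u ≠ G.distanceWeight f v

/-- The local distance antimagic chromatic number: the minimum, over all local distance antimagic
labelings, of the number of distinct weights (and `⊤` if there is no such labeling). -/
noncomputable def localDistanceAntimagicChromaticNumber : ℕ∞ :=
  ⨅ (f : V → ℕ) (_ : G.IsLocalDistanceAntimagic f), (Set.range (G.distanceWeight f)).encard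

end

end SimpleGraph

/-!
The weights of a local distance antimagic labeling are a proper coloring, and `G[H]` contains a
copy of `G`, so the chromatic number `3` of the odd cycle is a lower bound.

For the upper bound let `G` be a regular graph on `Fin m`. In `G[nK₁]` the weight of `(v, w)` is
the sum of the column sums over the neighbors of `v`. If each row is labeled by a block of `m`
consecutive integers, ordered by a row of a Kotzig array, all column sums agree. Replacing the row
of the array that is the identity by another permutation `τ` changes the column sum of `x` by
`τ x - x`, so the weights become, up to a constant, the sums of `τ x - x` over neighborhoods of `G`.
For the odd cycle the product `τ` of the transpositions `(1 2), (5 6), (9 10), …` makes these sums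
a proper coloring by `1`, `-1` and `0`.
-/

namespace LocalDistanceAntimagic

open SimpleGraph

section ChromaticNumber

variable {V W : Type*}

theorem chromaticNumber_le_localDistanceAntimagicChromaticNumber [Fintype V] (G : SimpleGraph V)
    [DecidableRel G.Adj] :
    G.chromaticNumber ≤ G.localDistanceAntimagicChromaticNumber := by
  refine le_iInf₂ fun f hf => ?_
  let weightColoring : G.Coloring (Set.range (G.distanceWeight f)) :=
    Coloring.mk (Set.rangeFactorization (G.distanceWeight f))
      fun huv heq => hf.weight_ne _ _ huv (congrArg Subtype.val heq)
  have := Fintype.ofFinite (Set.range (G.distanceWeight f))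
  rw [← Set.coe_fintypeCard]
  exact weightColoring.colorable.chromaticNumber_le

theorem chromaticNumber_le_chromaticNumber_lexProduct (G : SimpleGraph V) (H : SimpleGraph W)
    [Nonempty W] : G.chromaticNumber ≤ (lexProduct G H).chromaticNumber :=
  let w := Classical.arbitrary W
  chromaticNumber_mono_of_hom ⟨fun v => (v, w), Or.inl⟩

end ChromaticNumber

section LexProductBot

variable {V W : Type*}

theorem lexProduct_bot_adj {G : SimpleGraph V} {p q : V × W} :
    (lexProduct G (⊥ : SimpleGraph W)).Adj p q ↔ G.Adj p.1 q.1 := by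
  simp [lexProduct]

variable [Fintype V] [Fintype W] (G : SimpleGraph V) [DecidableRel G.Adj]
  [DecidableRel (lexProduct G (⊥ : SimpleGraph W)).Adj]

theorem neighborFinset_lexProduct_bot (p : V × W) :
    (lexProduct G ⊥).neighborFinset p = G.neighborFinset p.1 ×ˢ Finset.univ := by
  ext q
  simp [lexProduct_bot_adj]

theorem distanceWeight_lexProduct_bot (f : V × W → ℕ) (p : V × W) :
    (lexProduct G ⊥).distanceWeight f p = ∑ v ∈ G.neighborFinset p.1, ∑ w, f (v, w) := by
  rw [distanceWeight, neighborFinset_lexProduct_bot, Finset.sum_product]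

end LexProductBot

section KotzigArray

variable {m a b : ℕ}

/-- An array with `a` rows and `m` columns whose rows are permutations of `Fin m` and whose
columns all have the same sum. Such arrays are known as Kotzig arrays. -/
def IsKotzigArray (σ : Fin a → Equiv.Perm (Fin m)) : Prop :=
  ∃ c : ℕ, ∀ i, ∑ r, (σ r i : ℕ) = c

theorem IsKotzigArray.append {σ : Fin a → Equiv.Perm (Fin m)} {ρ : Fin b → Equiv.Perm (Fin m)}
    (hσ : IsKotzigArray σ) (hρ : IsKotzigArray ρ) : IsKotzigArray (Fin.append σ ρ) := by
  obtain ⟨c, hc⟩ := hσ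
  obtain ⟨d, hd⟩ := hρ
  exact ⟨c + d, fun i => by simp [Fin.sum_univ_add, hc, hd]⟩

theorem isKotzigArray_one_revPerm (m : ℕ) :
    IsKotzigArray ![1, (Fin.revPerm : Equiv.Perm (Fin m))] :=
  ⟨m - 1, fun i => by
    simp only [Fin.sum_univ_two, Matrix.cons_val, Equiv.Perm.one_apply, Fin.revPerm_apply,
      Fin.val_rev]
    omega⟩

/-- Multiplication by two modulo the odd number `2 * k + 1`. Its reversal is the last row of a
three-row Kotzig array. -/
noncomputable def doublePerm (k : ℕ) : Equiv.Perm (Fin (2 * k + 1)) :=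
  Equiv.ofBijective (fun i => i + i) <| Finite.injective_iff_bijective.mp fun i j hij => by
    have := congrArg Fin.val hij
    simp only [Fin.val_add_eq_ite] at this
    grind

theorem isKotzigArray_one_addRight_double_rev (k : ℕ) :
    IsKotzigArray ![1, Equiv.addRight (⟨k, by omega⟩ : Fin (2 * k + 1)),
      (doublePerm k).trans Fin.revPerm] := by
  -- Modulo `2 * k + 1` the column is `i, i + k, -1 - 2 * i`. Both `i + k` and `2 * i` wrap around
  -- exactly when `k < i`, with opposite effects on the sum.
  refine ⟨3 * k, fun i => ?_⟩
  simp only [Fin.sum_univ_three, Matrix.cons_val, Equiv.Perm.one_apply, Equiv.coe_addRight,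
    Equiv.trans_apply, doublePerm, Equiv.ofBijective_apply, Fin.revPerm_apply, Fin.val_rev,
    Fin.val_add_eq_ite]
  grind

theorem exists_isKotzigArray_of_odd (hm : Odd m) :
    ∀ n : ℕ, 2 ≤ n → ∃ σ : Fin n → Equiv.Perm (Fin m), IsKotzigArray σ
  | 2, _ => ⟨_, isKotzigArray_one_revPerm m⟩
  | 3, _ => by
    obtain ⟨k, rfl⟩ := hm
    exact ⟨_, isKotzigArray_one_addRight_double_rev k⟩
  | n + 4, _ => by
    obtain ⟨σ, hσ⟩ := exists_isKotzigArray_of_odd hm (n + 2) (by omega)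
    exact ⟨_, hσ.append (isKotzigArray_one_revPerm m)⟩

theorem IsKotzigArray.exists_sum_eq_add_displacement [NeZero a]
    {σ : Fin a → Equiv.Perm (Fin m)} (hσ : IsKotzigArray σ) (τ : Equiv.Perm (Fin m)) :
    ∃ (ρ : Fin a → Equiv.Perm (Fin m)) (c : ℤ), ∀ i, ∑ r, (ρ r i : ℤ) = c + ((τ i : ℤ) - i) := by
  -- Permuting the columns turns the first row into the identity, which is then replaced by `τ`.
  obtain ⟨c, hc⟩ := hσ
  refine ⟨Function.update (fun r => σ r * (σ 0)⁻¹) 0 τ, c, fun i => ?_⟩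
  have hcol : ∑ r, ((σ r * (σ 0)⁻¹) i : ℤ) = c := mod_cast hc ((σ 0)⁻¹ i)
  rw [Fintype.sum_eq_add_sum_compl 0] at hcol ⊢
  have hrest : ∑ r ∈ {0}ᶜ, (Function.update (fun r => σ r * (σ 0)⁻¹) 0 τ r i : ℤ) =
      ∑ r ∈ {0}ᶜ, ((σ r * (σ 0)⁻¹) i : ℤ) :=
    Finset.sum_congr rfl fun r hr => by rw [Function.update_of_ne (by simpa using hr)]
  rw [hrest, Function.update_self]
  rw [mul_inv_cancel, Equiv.Perm.one_apply] at hcol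
  linarith

end KotzigArray

section StackedLabeling

variable {m n : ℕ}

theorem bijOn_equiv_fin_add_one {V : Type*} {N : ℕ} (e : V ≃ Fin N) :
    Set.BijOn (fun v => (e v : ℕ) + 1) Set.univ (Set.Icc 1 N) := by
  refine ⟨fun v _ => ⟨by simp, (e v).isLt⟩,
    fun u _ v _ huv => e.injective (Fin.ext (Nat.add_right_cancel huv)), fun k hk => ?_⟩
  exact ⟨e.symm ⟨k - 1, by grind⟩, trivial, by grind⟩

/-- The labeling of `Fin m × Fin n` that gives the labels `m * r + 1, …, m * r + m` to the row
`Fin m × {r}`, in the order prescribed by the permutation `σ r`. -/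
def stackedLabel (σ : Fin n → Equiv.Perm (Fin m)) (p : Fin m × Fin n) : ℕ :=
  σ p.2 p.1 + m * p.2 + 1

theorem bijOn_stackedLabel (σ : Fin n → Equiv.Perm (Fin m)) :
    Set.BijOn (stackedLabel σ) Set.univ (Set.Icc 1 (Fintype.card (Fin m × Fin n))) := by
  have hcard : Fintype.card (Fin m × Fin n) = n * m := by
    rw [Fintype.card_prod, Fintype.card_fin, Fintype.card_fin, mul_comm]
  rw [hcard]
  exact bijOn_equiv_fin_add_one
    (((Equiv.prodComm _ _).trans ((Equiv.refl _).prodShear σ)).trans finProdFinEquiv)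

variable (G : SimpleGraph (Fin m)) [DecidableRel G.Adj]

/-- The sum of the displacements `τ x - x` over the neighbors `x` of `v`. It is the part of the
weight of `(v, w)` that depends on the vertex when `G` is regular and the column sums of the
labeling are, up to a constant, the displacements of `τ`. -/
def displacementWeight (τ : Equiv.Perm (Fin m)) (v : Fin m) : ℤ :=
  ∑ x ∈ G.neighborFinset v, ((τ x : ℤ) - x)

variable {G} [DecidableRel (lexProduct G (⊥ : SimpleGraph (Fin n))).Adj] {d : ℕ}

theorem exists_distanceWeight_stackedLabel_eq (hG : G.IsRegularOfDegree d)
    {σ : Fin n → Equiv.Perm (Fin m)} {τ : Equiv.Perm (Fin m)} {c : ℤ}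
    (hσ : ∀ i, ∑ r, (σ r i : ℤ) = c + ((τ i : ℤ) - i)) :
    ∃ D : ℤ, ∀ p, ((lexProduct G ⊥).distanceWeight (stackedLabel σ) p : ℤ) =
      D + displacementWeight G τ p.1 := by
  let base : ℤ := ∑ r : Fin n, ((m : ℤ) * r + 1)
  have hcol (i : Fin m) : ((∑ r, stackedLabel σ (i, r) : ℕ) : ℤ) =
      c + base + ((τ i : ℤ) - i) := by
    simp only [stackedLabel, Nat.cast_sum, Nat.cast_add, Nat.cast_mul, Nat.cast_one, add_assoc,
      Finset.sum_add_distrib, hσ, base]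
    ring
  refine ⟨d * (c + base), fun p => ?_⟩
  rw [distanceWeight_lexProduct_bot, Nat.cast_sum, Finset.sum_congr rfl fun i _ => hcol i,
    Finset.sum_add_distrib, Finset.sum_const, card_neighborFinset_eq_degree, hG.degree_eq,
    nsmul_eq_mul, displacementWeight]

theorem localDistanceAntimagicChromaticNumber_lexProduct_bot_le [NeZero n]
    (hG : G.IsRegularOfDegree d) {σ : Fin n → Equiv.Perm (Fin m)} (hσ : IsKotzigArray σ)
    {τ : Equiv.Perm (Fin m)}
    (hτ : ∀ u v, G.Adj u v → displacementWeight G τ u ≠ displacementWeight G τ v) :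
    (lexProduct G (⊥ : SimpleGraph (Fin n))).localDistanceAntimagicChromaticNumber ≤
      (Set.range (displacementWeight G τ)).encard := by
  obtain ⟨ρ, c, hρ⟩ := hσ.exists_sum_eq_add_displacement τ
  obtain ⟨D, hD⟩ := exists_distanceWeight_stackedLabel_eq hG hρ
  have hlabel : (lexProduct G (⊥ : SimpleGraph (Fin n))).IsLocalDistanceAntimagic
      (stackedLabel ρ) := by
    refine ⟨bijOn_stackedLabel ρ, fun p q hpq heq => ?_⟩
    have hweight : D + displacementWeight G τ p.1 = D + displacementWeight G τ q.1 := by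
      rw [← hD, ← hD, heq]
    exact hτ _ _ (lexProduct_bot_adj.mp hpq) (add_left_cancel hweight)
  have hrange : Set.range ((lexProduct G ⊥).distanceWeight (stackedLabel ρ)) ⊆
      (fun z : ℤ => (D + z).toNat) '' Set.range (displacementWeight G τ) := by
    rintro _ ⟨p, rfl⟩
    exact ⟨_, ⟨p.1, rfl⟩, by simp only [← hD, Int.toNat_natCast]⟩
  exact (iInf₂_le _ hlabel).trans
    ((Set.encard_le_encard hrange).trans (Set.encard_image_le _ _))

end StackedLabeling

section OddCycle

variable {k : ℕ}

theorem sum_neighborFinset_cycleGraph {M : Type*} [AddCommMonoid M] (F : Fin (k + 3) → M)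
    (i : Fin (k + 3)) :
    ∑ j ∈ (cycleGraph (k + 3)).neighborFinset i, F j = F (i - 1) + F (i + 1) := by
  have hne : i - 1 ≠ i + 1 := by
    simp only [ne_eq, Fin.ext_iff, Fin.coe_sub_one, Fin.val_add_one, Fin.val_last, Fin.val_zero]
    grind
  rw [cycleGraph_neighborFinset, Finset.sum_pair hne]

theorem isRegularOfDegree_cycleGraph (k : ℕ) : (cycleGraph (k + 3)).IsRegularOfDegree 2 :=
  fun _ => cycleGraph_degree_three_le

/-- The involution of `ℕ` exchanging `4 * q + 1` and `4 * q + 2` for every `q`. Its displacements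
`0, 1, -1, 0, 0, 1, -1, 0, …` have period four, so that their sums over two positions at distance
two alternate between `1` and `-1`. -/
def swapMiddle (i : ℕ) : ℕ :=
  if i % 4 = 1 then i + 1 else if i % 4 = 2 then i - 1 else i

theorem swapMiddle_lt_of_odd {m i : ℕ} (hm : Odd m) (hi : i < m) : swapMiddle i < m := by
  grind [swapMiddle]

theorem swapMiddle_involutive : Function.Involutive swapMiddle := by
  intro i
  grind [swapMiddle]

/-- The restriction of `swapMiddle` to `Fin m` for odd `m`. -/
def swapMiddlePerm {m : ℕ} (hm : Odd m) : Equiv.Perm (Fin m) :=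
  Function.Involutive.toPerm (fun i => ⟨swapMiddle i, swapMiddle_lt_of_odd hm i.isLt⟩)
    fun i => Fin.ext (swapMiddle_involutive i)

theorem swapMiddlePerm_apply_sub_self {m : ℕ} (hm : Odd m) (i : Fin m) :
    (swapMiddlePerm hm i : ℤ) - i =
      if (i : ℕ) % 4 = 1 then 1 else if (i : ℕ) % 4 = 2 then -1 else 0 := by
  change (swapMiddle i : ℤ) - i = _
  grind [swapMiddle]

/-- The proper coloring of the cycle of odd length `m` that alternates between `1` and `-1` except
for one vertex of color `0`: the last one if `m % 4 = 1` and the first one if `m % 4 = 3`. -/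
def oddCycleColor (m i : ℕ) : ℤ :=
  if (m % 4 = 1 ∧ i + 1 = m) ∨ (m % 4 = 3 ∧ i = 0) then 0 else if Even i then 1 else -1

theorem displacementWeight_cycleGraph_swapMiddlePerm (hk : Odd (k + 3)) (i : Fin (k + 3)) :
    displacementWeight (cycleGraph (k + 3)) (swapMiddlePerm hk) i = oddCycleColor (k + 3) i := by
  rw [displacementWeight, sum_neighborFinset_cycleGraph, swapMiddlePerm_apply_sub_self,
    swapMiddlePerm_apply_sub_self]
  simp only [Fin.coe_sub_one, Fin.val_add_one, Fin.ext_iff, Fin.val_last, Fin.val_zero]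
  grind [oddCycleColor]

theorem oddCycleColor_ne_of_adj (hk : Odd (k + 3)) {i j : Fin (k + 3)}
    (hij : (cycleGraph (k + 3)).Adj i j) :
    oddCycleColor (k + 3) i ≠ oddCycleColor (k + 3) j := by
  have hsucc (a : Fin (k + 3)) :
      oddCycleColor (k + 3) a ≠ oddCycleColor (k + 3) (a + 1 : Fin (k + 3)) := by
    rw [Fin.val_add_one]
    grind [oddCycleColor]
  rcases cycleGraph_adj.mp hij with h | h <;> rw [sub_eq_iff_eq_add'.mp h]
  · exact (hsucc j).symm
  · exact hsucc i

theorem encard_range_displacementWeight_le (hk : Odd (k + 3)) :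
    (Set.range (displacementWeight (cycleGraph (k + 3)) (swapMiddlePerm hk))).encard ≤ 3 := by
  have hsub : Set.range (displacementWeight (cycleGraph (k + 3)) (swapMiddlePerm hk)) ⊆
      (({-1, 0, 1} : Finset ℤ) : Set ℤ) := by
    rintro _ ⟨i, rfl⟩
    rw [displacementWeight_cycleGraph_swapMiddlePerm]
    grind [oddCycleColor]
  exact (Set.encard_le_encard hsub).trans (Set.encard_coe_eq_coe_finsetCard _).le

end OddCycle

end LocalDistanceAntimagic

open LocalDistanceAntimagic in
theorem mainTheorem9_general (m n : ℕ) (hm : 3 ≤ m) (hodd : Odd m) (hn : 2 ≤ n) :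
    (SimpleGraph.lexProduct (SimpleGraph.cycleGraph m)
      (SimpleGraph.completeGraph (Fin n))ᶜ).localDistanceAntimagicChromaticNumber = 3 := by
  obtain ⟨k, rfl⟩ := Nat.exists_eq_add_of_le' hm
  have : NeZero n := ⟨by omega⟩
  apply le_antisymm
  · obtain ⟨σ, hσ⟩ := exists_isKotzigArray_of_odd hodd n hn
    simp only [SimpleGraph.completeGraph_eq_top, compl_top]
    refine (localDistanceAntimagicChromaticNumber_lexProduct_bot_le (isRegularOfDegree_cycleGraph k)
      hσ fun u v huv => ?_).trans (encard_range_displacementWeight_le hodd)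
    simpa only [displacementWeight_cycleGraph_swapMiddlePerm] using oddCycleColor_ne_of_adj hodd huv
  · rw [← SimpleGraph.chromaticNumber_cycleGraph_of_odd (k + 3) (by omega) hodd]
    exact (chromaticNumber_le_chromaticNumber_lexProduct _ _).trans
      (chromaticNumber_le_localDistanceAntimagicChromaticNumber _)

theorem mainTheorem9 (m n : ℕ) (hm : 5 ≤ m) (hodd : Odd m) (hn : 3 ≤ n) :
    (SimpleGraph.lexProduct (SimpleGraph.cycleGraph m)
      (SimpleGraph.completeGraph (Fin n))ᶜ).localDistanceAntimagicChromaticNumber = 3 := by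
  exact mainTheorem9_general m n (by omega) hodd (by omega)
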